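/- Let $d\in\mathbb N$ (in the application $d=2,3$), let $\Omega\subset\mathbb R^d$ be open and bounded, and write $(\cdot,\cdot)$, $\|\cdot\|_0$ for the $L^2(\Omega)$ scalar product and norm, $\|\cdot\|_1$ for the norm of $H^1(\Omega;\mathbb R^d)$ and $|v|_1=\|\nabla v\|_0$. Put $a(u,v)=2\mu(\varepsilon(u),\varepsilon(v))$ with the symmetric gradient $\varepsilon$, and $b(q,v)=(q,\nabla\cdot v)$. Let $H^{\mathrm{div}}(\Omega)$ be the space of $v\in L^2(\Omega)^d$ with $\nabla\cdot v\in L^2(\Omega)$; the fields in it with $v\cdot n=0$ on $\partial\Omega$ are those in the closure of $C_c^\infty(\Omega;\mathbb R^d)$ in $H^{\mathrm{div}}(\Omega)$. For every discretization parameter $h$ let finite-dimensional subspaces $V_h\subset H^1_0(\Omega;\mathbb R^d)$ and $Q_h\subset L^2(\Omega)$ and a linear operator $\pi^{\mathrm{div}}\colon V_h\to H^{\mathrm{div}}(\Omega)$ be given such that: * there is $\beta>0$, independent of $h$, with $$\inf_{0\ne q_h\in Q_h,\ \int_\Omega q_h=0}\ \sup_{0\ne v_h\in V_h}\frac{(q_h,\nabla\cdot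 v_h)}{\|q_h\|_0\,|v_h|_1}\ge\beta ;$$ * the diagram $\nabla\cdot(\pi^{\mathrm{div}}v_h)=\pi^{L^2}(\nabla\cdot v_h)$ commutes for all $v_h\in V_h$, where $\pi^{L^2}$ is the $L^2$-projection onto $Q_h$, i.e. $\nabla\cdot\pi^{\mathrm{div}}v_h\in Q_h$ and $b(q_h,\pi^{\mathrm{div}}v_h)=b(q_h,v_h)$ for all $q_h\in Q_h$; in particular $\nabla\cdot\pi^{\mathrm{div}}v_h=0$ whenever $b(q_h,v_h)=0$ for all $q_h\in Q_h$; * $\pi^{\mathrm{div}}v_h\cdot n=0$ on $\partial\Omega$ for all $v_h\in V_h$. For $\mu>0$, $0<\lambda<\infty$ and a force $f$ the modified scheme is: find $(u_h,p_h)\in V_h\times Q_h$ with $$a(u_h,v_h)+b(p_h,v_h)=(f,\pi^{\mathrm{div}}v_h)\quad\forall v_h\in V_h,\qquad b(q_h,u_h)-\tfrac1\lambda(p_h,q_h)=0\quad\forall q_h\in Q_h .$$ Let $f=\nabla\phi\in H^{-1}(\Omega;\mathbb R^d)$ with $\phi\in L^2(\Omega)$; here $(f,w)$, for $w\in H^{\mathrm{div}}(\Omega)$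 with $w\cdot n=0$ on $\partial\Omega$, is the continuous linear extension of the distributional gradient of $\phi$ from $C_c^\infty(\Omega;\mathbb R^d)$ to these fields. **Theorem.** There is a constant $c>0$, independent of $h$, $\mu$, $\lambda$ and $\phi$, such that for every $h$, $\mu>0$, $0<\lambda<\infty$, $\phi\in L^2(\Omega)$ and $f=\nabla\phi$ the modified scheme has exactly one solution $(u_h,p_h)$, and $$\|u_h\|_1\le \frac{c}{\lambda+\mu}\,\|\phi\|_0 .$$ Consequently the discretization is gradient robust: for every $h$ there is a constant $c_h$ such that, for all $\mu,\lambda>0$ and all gradient forces $f=\nabla\phi$ with $\phi\in L^2(\Omega)$, the approximate displacement satisfies $\|u_h\|_1\le\frac{c_h}{\lambda}\|\phi\|_0$. -/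

import Mathlib

open MeasureTheory Filter Topology
open scoped ContDiff

namespace Elasticity

/-- Real-valued square integrable functions on `Ω ⊆ ℝᵈ`; its inner product and norm are the scalar
product `(·,·)` and the norm `‖·‖₀`. -/
abbrev L2 {d : ℕ} (Ω : Set (EuclideanSpace ℝ (Fin d))) : Type :=
  Lp ℝ 2 (volume.restrict Ω)

/-- Vector fields in `L²(Ω; ℝᵈ)`, given by their components. -/
abbrev Field {d : ℕ} (Ω : Set (EuclideanSpace ℝ (Fin d))) : Type :=
  Fin d → L2 Ω

/-- Test functions: the elements of `C_c^∞(Ω)`. -/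
def IsTest {d : ℕ} (Ω : Set (EuclideanSpace ℝ (Fin d))) (ψ : EuclideanSpace ℝ (Fin d) → ℝ) : Prop :=
  ContDiff ℝ ∞ ψ ∧ HasCompactSupport ψ ∧ tsupport ψ ⊆ Ω

/-- The classical partial derivative `∂ⱼψ`. -/
noncomputable def pderiv {d : ℕ} (j : Fin d) (ψ : EuclideanSpace ℝ (Fin d) → ℝ)
    (x : EuclideanSpace ℝ (Fin d)) : ℝ :=
  fderiv ℝ ψ x (EuclideanSpace.single j 1)

variable {d : ℕ} {Ω : Set (EuclideanSpace ℝ (Fin d))}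

/-! ### Weak derivatives -/

/-- `g` is the weak partial derivative `∂ⱼu` on `Ω`. -/
def HasWeakPartial (j : Fin d) (u g : L2 Ω) : Prop :=
  ∀ ψ, IsTest Ω ψ → ∫ x in Ω, u x * pderiv j ψ x = -∫ x in Ω, g x * ψ x

/-- `g` is the weak divergence of the vector field `w` on `Ω`. -/
def HasWeakDiv (w : Field Ω) (g : L2 Ω) : Prop :=
  ∀ ψ, IsTest Ω ψ → ∑ i, ∫ x in Ω, w i x * pderiv i ψ x = -∫ x in Ω, g x * ψ x

/-- An `L²` function is determined by its integrals against test functions. -/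
theorem eq_of_integral_test_eq (hΩ : IsOpen Ω) {g g' : L2 Ω}
    (h : ∀ ψ, IsTest Ω ψ → ∫ x in Ω, g x * ψ x = ∫ x in Ω, g' x * ψ x) : g = g' := by
  have hint : ∀ f : L2 Ω, LocallyIntegrable f (volume.restrict Ω) := fun f =>
    (Lp.memLp f).locallyIntegrable (by norm_num)
  have hmul : ∀ (f : L2 Ω) ψ, IsTest Ω ψ →
      Integrable (fun x => f x * ψ x) (volume.restrict Ω) := fun f ψ hψ => by
    have := (hint f).integrable_smul_left_of_hasCompactSupport hψ.1.continuous hψ.2.1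
    simpa [mul_comm] using this
  have key : ∀ᵐ x ∂(volume : Measure (EuclideanSpace ℝ (Fin d))), x ∈ Ω → g x - g' x = 0 := by
    refine hΩ.ae_eq_zero_of_integral_contDiff_smul_eq_zero (f := fun x => g x - g' x) ?_ ?_
    · have h2 : LocallyIntegrable (fun x => g x - g' x) (volume.restrict Ω) :=
        (hint g).sub (hint g')
      exact locallyIntegrableOn_of_locallyIntegrable_restrict h2
    · intro ψ h1 h2 h3
      have hψ : IsTest Ω ψ := ⟨h1, h2, h3⟩
      have e : ∫ x, ψ x • (g x - g' x) = ∫ x in Ω, ψ x • (g x - g' x) := by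
        refine (setIntegral_eq_integral_of_forall_compl_eq_zero fun x hx => ?_).symm
        rw [image_eq_zero_of_notMem_tsupport fun hx' => hx (h3 hx'), zero_smul]
      rw [e]
      have e2 : (fun x => ψ x • (g x - g' x)) = fun x => g x * ψ x - g' x * ψ x := by
        funext x; simp only [smul_eq_mul]; ring
      rw [e2, integral_sub (hmul g ψ hψ) (hmul g' ψ hψ), h ψ hψ, sub_self]
  refine Lp.ext ?_
  rw [EventuallyEq, ae_restrict_iff' hΩ.measurableSet]
  filter_upwards [key] with x hx hxΩ
  exact sub_eq_zero.mp (hx hxΩ)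

theorem HasWeakPartial.unique (hΩ : IsOpen Ω) {j : Fin d} {u g g' : L2 Ω}
    (h : HasWeakPartial j u g) (h' : HasWeakPartial j u g') : g = g' :=
  eq_of_integral_test_eq hΩ fun ψ hψ => neg_injective ((h ψ hψ).symm.trans (h' ψ hψ))

theorem HasWeakDiv.unique (hΩ : IsOpen Ω) {w : Field Ω} {g g' : L2 Ω}
    (h : HasWeakDiv w g) (h' : HasWeakDiv w g') : g = g' :=
  eq_of_integral_test_eq hΩ fun ψ hψ => neg_injective ((h ψ hψ).symm.trans (h' ψ hψ))

open Classical in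
/-- The weak partial derivative `∂ⱼu ∈ L²(Ω)` (zero if there is none). -/
noncomputable def weakPartial (j : Fin d) (u : L2 Ω) : L2 Ω :=
  if h : ∃ g, HasWeakPartial j u g then h.choose else 0

open Classical in
/-- The weak divergence `∇ · w ∈ L²(Ω)` (zero if there is none). -/
noncomputable def weakDiv (w : Field Ω) : L2 Ω :=
  if h : ∃ g, HasWeakDiv w g then h.choose else 0

/-! ### Function spaces -/

/-- `H¹₀(Ω)`: functions with weak partial derivatives in `L²(Ω)` that are limits of test functions
in the `H¹` norm. -/
def MemH10 (u : L2 Ω) : Prop :=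
  (∀ j, ∃ g, HasWeakPartial j u g) ∧
  ∃ ψ : ℕ → EuclideanSpace ℝ (Fin d) → ℝ, (∀ n, IsTest Ω (ψ n)) ∧
    Tendsto (fun n => eLpNorm (fun x => ψ n x - u x) 2 (volume.restrict Ω)) atTop (𝓝 0) ∧
    ∀ j, Tendsto (fun n => eLpNorm (fun x => pderiv j (ψ n) x - weakPartial j u x) 2
      (volume.restrict Ω)) atTop (𝓝 0)

/-- `H^div(Ω)`: fields in `L²` whose weak divergence exists in `L²`. -/
def MemHdiv (w : Field Ω) : Prop :=
  ∃ g, HasWeakDiv w g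

/-- The norm of `H^div(Ω)`. -/
noncomputable def hdivNorm (w : Field Ω) : ℝ :=
  Real.sqrt (∑ i, ‖w i‖ ^ 2 + ‖weakDiv w‖ ^ 2)

/-- The fields in `H^div(Ω)` with vanishing normal trace, `w · n = 0` on `∂Ω`: the closure of
`C_c^∞(Ω; ℝᵈ)` in the norm of `H^div(Ω)`. -/
def MemHdivZeroTrace (w : Field Ω) : Prop :=
  MemHdiv w ∧
  ∃ Ψ : ℕ → Fin d → EuclideanSpace ℝ (Fin d) → ℝ, (∀ n i, IsTest Ω (Ψ n i)) ∧
    (∀ i, Tendsto (fun n => eLpNorm (fun x => Ψ n i x - w i x) 2 (volume.restrict Ω))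
      atTop (𝓝 0)) ∧
    Tendsto (fun n => eLpNorm (fun x => ∑ i, pderiv i (Ψ n i) x - weakDiv w x) 2
      (volume.restrict Ω)) atTop (𝓝 0)

/-- The seminorm `|u|₁ = ‖∇u‖₀`. -/
noncomputable def h1Seminorm (u : Field Ω) : ℝ :=
  Real.sqrt (∑ i, ∑ j, ‖weakPartial j (u i)‖ ^ 2)

/-- The norm `‖u‖₁` of `H¹(Ω; ℝᵈ)`. -/
noncomputable def h1Norm (u : Field Ω) : ℝ :=
  Real.sqrt (∑ i, ‖u i‖ ^ 2 + ∑ i, ∑ j, ‖weakPartial j (u i)‖ ^ 2)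

/-! ### The bilinear forms -/

/-- The entry `ε(u)ᵢⱼ` of the symmetric gradient. -/
noncomputable def strain (u : Field Ω) (i j : Fin d) : L2 Ω :=
  (1 / 2 : ℝ) • (weakPartial j (u i) + weakPartial i (u j))

/-- `a(u, v) = 2μ (ε(u), ε(v))`. -/
noncomputable def formA (mu : ℝ) (u v : Field Ω) : ℝ :=
  2 * mu * ∑ i, ∑ j, inner ℝ (strain u i j) (strain v i j)

/-- `b(q, v) = (q, ∇ · v)`. -/
noncomputable def formB (q : L2 Ω) (v : Field Ω) : ℝ :=
  inner ℝ q (weakDiv v)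

/-! ### Gradient forces -/

/-- `f = ∇φ` with `φ ∈ L²(Ω)`, acting on fields of `H^div(Ω)` with vanishing normal trace: `f` is a
bounded linear functional on this space, and on `C_c^∞(Ω; ℝᵈ)` it is the distributional gradient
of `φ`. (Values of `f` on other fields are irrelevant.) -/
structure IsGradientForce (φ : L2 Ω) (f : Field Ω → ℝ) : Prop where
  map_add : ∀ w w', MemHdivZeroTrace w → MemHdivZeroTrace w' → f (w + w') = f w + f w'
  map_smul : ∀ (r : ℝ) w, MemHdivZeroTrace w → f (r • w) = r * f w
  bounded : ∃ C : ℝ, ∀ w, MemHdivZeroTrace w → |f w| ≤ C * hdivNorm w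
  eq_grad : ∀ Ψ : Fin d → EuclideanSpace ℝ (Fin d) → ℝ, (∀ i, IsTest Ω (Ψ i)) →
    ∀ w : Field Ω, (∀ i, w i =ᵐ[volume.restrict Ω] Ψ i) →
      f w = -∫ x in Ω, φ x * ∑ i, pderiv i (Ψ i) x

/-! ### The discretization -/

/-- Discrete spaces `V_h ⊆ H¹₀(Ω; ℝᵈ)`, `Q_h ⊆ L²(Ω)` and an operator `π^div` on `V_h`. -/
structure MixedMethod {d : ℕ} (Ω : Set (EuclideanSpace ℝ (Fin d))) where
  V : Submodule ℝ (Field Ω)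
  Q : Submodule ℝ (L2 Ω)
  finiteDimensional_V : FiniteDimensional ℝ V
  finiteDimensional_Q : FiniteDimensional ℝ Q
  V_subset : ∀ v ∈ V, ∀ i, MemH10 (v i)
  recon : V →ₗ[ℝ] Field Ω

namespace MixedMethod

/-- The inf-sup condition with constant `β`, over the discrete pressures of mean value zero. -/
def InfSup (D : MixedMethod Ω) (β : ℝ) : Prop :=
  (β : EReal) ≤ ⨅ q ∈ {q : L2 Ω | q ∈ D.Q ∧ ∫ x in Ω, q x = 0 ∧ q ≠ 0},
    ⨆ v ∈ {v : Field Ω | v ∈ D.V ∧ v ≠ 0},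
      ((formB q v / (‖q‖ * h1Seminorm v) : ℝ) : EReal)

/-- The requirements on the reconstruction operator. The fields `div_mem` and `formB_eq` together
are the commuting diagram `∇ · π^div v = π^{L²} (∇ · v)`, with `π^{L²}` the `L²` projection
onto `Q_h`. -/
structure IsReconstruction (D : MixedMethod Ω) : Prop where
  memHdiv : ∀ v : D.V, MemHdiv (D.recon v)
  div_mem : ∀ v : D.V, weakDiv (D.recon v) ∈ D.Q
  formB_eq : ∀ v : D.V, ∀ q ∈ D.Q, formB q (D.recon v) = formB q v
  div_eq_zero : ∀ v : D.V, (∀ q ∈ D.Q, formB q v = 0) → weakDiv (D.recon v) = 0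
  zeroTrace : ∀ v : D.V, MemHdivZeroTrace (D.recon v)

/-- `(u, p)` solves the modified discrete problem with right hand side `(f, π^div v)`. -/
def IsSolution (D : MixedMethod Ω) (mu lam : ℝ) (f : Field Ω → ℝ) (u : Field Ω) (p : L2 Ω) :
    Prop :=
  u ∈ D.V ∧ p ∈ D.Q ∧
  (∀ v : D.V, formA mu u v + formB p v = f (D.recon v)) ∧
  ∀ q ∈ D.Q, formB q u - 1 / lam * inner ℝ p q = 0

end MixedMethod

/-- Gradient robustness of a discretization. `S h μ λ f u` says that `u` is the approximate
displacement for the discretization parameter `h`, the Lamé parameters `μ`, `λ` and the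
force `f`. -/
def GradientRobust {ι : Type*} (S : ι → ℝ → ℝ → (Field Ω → ℝ) → Field Ω → Prop) : Prop :=
  ∀ h, ∃ c : ℝ, ∀ mu lam : ℝ, 0 < mu → 0 < lam →
    ∀ (φ : L2 Ω) (f : Field Ω → ℝ), IsGradientForce φ f →
      ∀ u, S h mu lam f u → h1Norm u ≤ c / lam * ‖φ‖

end Elasticity

namespace Elasticity

variable {d : ℕ} {Ω : Set (EuclideanSpace ℝ (Fin d))}
  {ψ χ : EuclideanSpace ℝ (Fin d) → ℝ}

/-! ### Test functions -/

/-! The reconstruction lets a gradient force be absorbed by the discrete pressure. By density of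
test fields, `f (π^div v) = -(φ, ∇·π^div v)` (`IsGradientForce.apply_eq`). Since `∇·π^div v` lies in
`Q_h`, `φ` may be replaced by its projection `P` onto `Q_h`, and the commuting diagram turns this
into `-(P, ∇·v)`. With `r = p + P` the momentum equation becomes `a(u, v) = -(r, ∇·v)`.

Testing with `u` and `r` gives `λ a(u, u) = -(p, p + P)`, hence `‖p‖ ≤ ‖φ‖` and a bound for
`μ‖ε(u)‖`. The fields `π^div v` have zero normal trace, so only the mean-free part `r₀` of `r` acts,
and inf-sup gives `β‖r₀‖ ≤ 2μ‖ε(u)‖`. Inserted in the energy identity, this cancels `μ` and bounds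
`λ‖ε(u)‖`. Adding both bounds is `saddle_estimate`; Korn (`two_mul_sum_strain_sq`) and Poincaré
(`h1Norm_le`) pass to the `H¹` norm. Unique solvability (`saddle_existsUnique`) needs only
injectivity of `ε` on `V_h`. -/

theorem IsTest.memLp (hψ : IsTest Ω ψ) : MemLp ψ 2 (volume.restrict Ω) :=
  hψ.1.continuous.memLp_of_hasCompactSupport hψ.2.1

/-- The element of `L²(Ω)` given by a test function. -/
noncomputable def IsTest.toL2 (hψ : IsTest Ω ψ) : L2 Ω :=
  hψ.memLp.toLp ψ

theorem IsTest.coeFn_toL2 (hψ : IsTest Ω ψ) : hψ.toL2 =ᵐ[volume.restrict Ω] ψ :=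
  hψ.memLp.coeFn_toLp

theorem IsTest.inner_toL2 (hψ : IsTest Ω ψ) (u : L2 Ω) :
    inner ℝ u hψ.toL2 = ∫ x in Ω, u x * ψ x := by
  rw [L2.inner_def]
  refine integral_congr_ae ?_
  filter_upwards [hψ.coeFn_toL2] with x hx
  simp [hx, mul_comm]

theorem IsTest.pderiv (hψ : IsTest Ω ψ) (j : Fin d) : IsTest Ω (pderiv j ψ) := by
  refine ⟨?_, hψ.2.1.fderiv_apply (𝕜 := ℝ) _, (tsupport_fderiv_apply_subset ℝ _).trans hψ.2.2⟩
  exact (hψ.1.fderiv_right (m := ∞) (by simp)).clm_apply contDiff_const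

theorem isTest_zero : IsTest Ω (fun _ => (0 : ℝ)) :=
  ⟨contDiff_const, HasCompactSupport.zero, by simp [tsupport]⟩

theorem IsTest.add (hψ : IsTest Ω ψ) (hχ : IsTest Ω χ) : IsTest Ω (fun x => ψ x + χ x) :=
  ⟨hψ.1.add hχ.1, hψ.2.1.add hχ.2.1,
    (tsupport_add ψ χ).trans (Set.union_subset hψ.2.2 hχ.2.2)⟩

theorem IsTest.sum {α : Type*} (s : Finset α) {Ψ : α → EuclideanSpace ℝ (Fin d) → ℝ}
    (h : ∀ i, IsTest Ω (Ψ i)) : IsTest Ω (fun x => ∑ i ∈ s, Ψ i x) := by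
  classical
  induction s using Finset.induction_on with
  | empty => simpa using isTest_zero
  | insert a s ha ih =>
    simp only [Finset.sum_insert ha]
    exact (h a).add ih

/-- The multiplier `x j` has derivative one in direction `j`, which makes this the test function for
Poincaré's inequality. -/
theorem IsTest.coord_mul (hψ : IsTest Ω ψ) (j : Fin d) : IsTest Ω (fun x => x j * ψ x) :=
  ⟨(EuclideanSpace.proj (𝕜 := ℝ) j).contDiff.mul hψ.1, hψ.2.1.mul_left,
    (tsupport_mul_subset_right (f := fun x : EuclideanSpace ℝ (Fin d) => x j)).trans hψ.2.2⟩

theorem IsTest.differentiable (hψ : IsTest Ω ψ) : Differentiable ℝ ψ :=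
  hψ.1.differentiable (by simp)

theorem pderiv_coord_mul (hψ : IsTest Ω ψ) (j : Fin d) (x : EuclideanSpace ℝ (Fin d)) :
    Elasticity.pderiv j (fun x => x j * ψ x) x = ψ x + x j * Elasticity.pderiv j ψ x := by
  have h := ((EuclideanSpace.proj (𝕜 := ℝ) j).hasFDerivAt (x := x)).mul
    (hψ.differentiable x).hasFDerivAt
  have h' : fderiv ℝ (fun x : EuclideanSpace ℝ (Fin d) => x j * ψ x) x = _ := h.fderiv
  simp only [Elasticity.pderiv, h']
  simp [add_comm]

theorem pderiv_comm (hψ : IsTest Ω ψ) (i j : Fin d) :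
    Elasticity.pderiv i (Elasticity.pderiv j ψ) = Elasticity.pderiv j (Elasticity.pderiv i ψ) := by
  funext x
  have hd : DifferentiableAt ℝ (fderiv ℝ ψ) x :=
    (hψ.1.fderiv_right (m := ∞) (by simp)).differentiable (by simp) x
  have e : ∀ k l : Fin d, Elasticity.pderiv k (Elasticity.pderiv l ψ) x =
      fderiv ℝ (fderiv ℝ ψ) x (EuclideanSpace.single k 1) (EuclideanSpace.single l 1) := by
    intro k l
    have := (hd.hasFDerivAt.clm_apply
      (hasFDerivAt_const (EuclideanSpace.single l (1 : ℝ)) x)).fderiv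
    have h' : fderiv ℝ (Elasticity.pderiv l ψ) x = _ := this
    rw [Elasticity.pderiv, h']
    simp
  rw [e, e]
  exact (hψ.1.contDiffAt.isSymmSndFDerivAt (by
    rw [minSmoothness_of_isRCLikeNormedField]
    exact WithTop.coe_le_coe.2 (le_top : (2 : ℕ∞) ≤ ⊤))) _ _

/-- Test functions vanish off `Ω`, so the integrals extend to the whole space, where integration by
parts has no boundary term. -/
theorem integral_mul_pderiv (hψ : IsTest Ω ψ) (hχ : IsTest Ω χ) (j : Fin d) :
    ∫ x in Ω, ψ x * Elasticity.pderiv j χ x = -∫ x in Ω, Elasticity.pderiv j ψ x * χ x := by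
  have e : ∀ {a b : EuclideanSpace ℝ (Fin d) → ℝ}, IsTest Ω a →
      ∫ x in Ω, a x * b x = ∫ x, a x * b x := fun ha =>
    setIntegral_eq_integral_of_forall_compl_eq_zero fun x hx => by
      rw [image_eq_zero_of_notMem_tsupport fun hx' => hx (ha.2.2 hx'), zero_mul]
  have hI : ∀ {a b : EuclideanSpace ℝ (Fin d) → ℝ}, IsTest Ω a → IsTest Ω b →
      Integrable (fun x => a x * b x) := fun ha hb =>
    (ha.1.continuous.mul hb.1.continuous).integrable_of_hasCompactSupport ha.2.1.mul_right
  rw [e hψ, e (hψ.pderiv j)]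
  exact integral_mul_fderiv_eq_neg_fderiv_mul_of_integrable (hI (hψ.pderiv j) hχ)
    (hI hψ (hχ.pderiv j)) (hI hψ hχ) (fun x _ => hψ.differentiable x)
    (fun x _ => hχ.differentiable x)

theorem integral_pderiv_eq_zero (hψ : IsTest Ω ψ) (j : Fin d) :
    ∫ x in Ω, Elasticity.pderiv j ψ x = 0 := by
  -- Integration by parts against the constant one, which need not be a test function.
  have h := integral_mul_fderiv_eq_neg_fderiv_mul_of_integrable (𝕜 := ℝ) (f := fun _ => (1 : ℝ))
    (g := ψ) (v := EuclideanSpace.single j (1 : ℝ)) (μ := volume) (by simp)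
    (by
      simp only [one_mul]
      exact (hψ.pderiv j).1.continuous.integrable_of_hasCompactSupport (hψ.pderiv j).2.1)
    (by simpa using hψ.1.continuous.integrable_of_hasCompactSupport hψ.2.1)
    (fun x _ => differentiableAt_const _) (fun x _ => hψ.differentiable x)
  rw [setIntegral_eq_integral_of_forall_compl_eq_zero fun x hx =>
    image_eq_zero_of_notMem_tsupport fun hx' => hx ((hψ.pderiv j).2.2 hx')]
  simpa [Elasticity.pderiv] using h

theorem tendsto_toL2 {ψ : ℕ → EuclideanSpace ℝ (Fin d) → ℝ} (hψ : ∀ n, IsTest Ω (ψ n)) (u : L2 Ω)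
    (h : Tendsto (fun n => eLpNorm (fun x => ψ n x - u x) 2 (volume.restrict Ω)) atTop (𝓝 0)) :
    Tendsto (fun n => (hψ n).toL2) atTop (𝓝 u) := by
  rw [Lp.tendsto_Lp_iff_tendsto_eLpNorm']
  refine h.congr fun n => eLpNorm_congr_ae ?_
  filter_upwards [(hψ n).coeFn_toL2] with x hx
  simp [hx]

/-! ### Weak derivatives -/

/-- In inner-product form, linearity and limits of weak derivatives become Hilbert space algebra. -/
theorem hasWeakPartial_iff {j : Fin d} {u g : L2 Ω} :
    HasWeakPartial j u g ↔
      ∀ ψ (hψ : IsTest Ω ψ), inner ℝ u (hψ.pderiv j).toL2 = -inner ℝ g hψ.toL2 := by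
  simp only [IsTest.inner_toL2]; rfl

theorem hasWeakDiv_iff {w : Field Ω} {g : L2 Ω} :
    HasWeakDiv w g ↔
      ∀ ψ (hψ : IsTest Ω ψ), ∑ i, inner ℝ (w i) (hψ.pderiv i).toL2 = -inner ℝ g hψ.toL2 := by
  simp only [IsTest.inner_toL2]; rfl

/-- The chosen derivative defaults to zero, so every rule for `weakPartial` must pass through
existence and uniqueness. -/
theorem HasWeakPartial.eq (hΩ : IsOpen Ω) {j : Fin d} {u g : L2 Ω} (h : HasWeakPartial j u g) :
    weakPartial j u = g := by
  have he : ∃ g, HasWeakPartial j u g := ⟨g, h⟩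
  rw [weakPartial, dif_pos he]
  exact he.choose_spec.unique hΩ h

theorem hasWeakPartial_weakPartial (hΩ : IsOpen Ω) {j : Fin d} {u : L2 Ω}
    (h : ∃ g, HasWeakPartial j u g) : HasWeakPartial j u (weakPartial j u) := by
  obtain ⟨g, hg⟩ := h
  rwa [hg.eq hΩ]

theorem HasWeakDiv.eq (hΩ : IsOpen Ω) {w : Field Ω} {g : L2 Ω} (h : HasWeakDiv w g) :
    weakDiv w = g := by
  have he : ∃ g, HasWeakDiv w g := ⟨g, h⟩
  rw [weakDiv, dif_pos he]
  exact he.choose_spec.unique hΩ h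

theorem MemHdiv.hasWeakDiv (hΩ : IsOpen Ω) {w : Field Ω} (h : MemHdiv w) :
    HasWeakDiv w (weakDiv w) := by
  obtain ⟨g, hg⟩ := h
  rwa [hg.eq hΩ]

theorem HasWeakPartial.add {j : Fin d} {u g u' g' : L2 Ω} (h : HasWeakPartial j u g)
    (h' : HasWeakPartial j u' g') : HasWeakPartial j (u + u') (g + g') := by
  rw [hasWeakPartial_iff] at *
  intro ψ hψ
  rw [inner_add_left, inner_add_left, h ψ hψ, h' ψ hψ]; ring

theorem HasWeakPartial.smul {j : Fin d} {u g : L2 Ω} (h : HasWeakPartial j u g) (r : ℝ) :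
    HasWeakPartial j (r • u) (r • g) := by
  rw [hasWeakPartial_iff] at *
  intro ψ hψ
  rw [real_inner_smul_left, real_inner_smul_left, h ψ hψ]; ring

theorem HasWeakDiv.add {w w' : Field Ω} {g g' : L2 Ω} (h : HasWeakDiv w g)
    (h' : HasWeakDiv w' g') : HasWeakDiv (w + w') (g + g') := by
  rw [hasWeakDiv_iff] at *
  intro ψ hψ
  simp only [Pi.add_apply, inner_add_left, Finset.sum_add_distrib, h ψ hψ, h' ψ hψ]; ring

theorem HasWeakDiv.smul {w : Field Ω} {g : L2 Ω} (h : HasWeakDiv w g) (r : ℝ) :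
    HasWeakDiv (r • w) (r • g) := by
  rw [hasWeakDiv_iff] at *
  intro ψ hψ
  simp only [Pi.smul_apply, real_inner_smul_left, ← Finset.mul_sum, h ψ hψ]; ring

theorem hasWeakDiv_of_hasWeakPartial {w : Field Ω} {g : Fin d → L2 Ω}
    (h : ∀ i, HasWeakPartial i (w i) (g i)) : HasWeakDiv w (∑ i, g i) := by
  rw [hasWeakDiv_iff]
  intro ψ hψ
  rw [sum_inner, ← Finset.sum_neg_distrib]
  exact Finset.sum_congr rfl fun i _ => hasWeakPartial_iff.1 (h i) ψ hψ

theorem IsTest.hasWeakPartial (hψ : IsTest Ω ψ) (j : Fin d) :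
    HasWeakPartial j hψ.toL2 (hψ.pderiv j).toL2 := by
  intro χ hχ
  have e : ∀ {a b : EuclideanSpace ℝ (Fin d) → ℝ} (ha : IsTest Ω a),
      ∫ x in Ω, ha.toL2 x * b x = ∫ x in Ω, a x * b x := fun ha => by
    refine integral_congr_ae ?_
    filter_upwards [ha.coeFn_toL2] with x hx
    rw [hx]
  rw [e, e, integral_mul_pderiv hψ hχ]

/-! ### Fields of `H^div` with vanishing normal trace -/

theorem hasWeakDiv_test {Ψ : Fin d → EuclideanSpace ℝ (Fin d) → ℝ} (hΨ : ∀ i, IsTest Ω (Ψ i)) :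
    HasWeakDiv (fun i => (hΨ i).toL2) (IsTest.sum Finset.univ fun i => (hΨ i).pderiv i).toL2 := by
  have h : (IsTest.sum Finset.univ fun i => (hΨ i).pderiv i).toL2 =
      ∑ i, ((hΨ i).pderiv i).toL2 := by
    refine Lp.ext ?_
    refine (IsTest.coeFn_toL2 _).trans ?_
    have h2 : ∀ᵐ x ∂volume.restrict Ω, ∀ i, ((hΨ i).pderiv i).toL2 x = Elasticity.pderiv i (Ψ i) x :=
      ae_all_iff.2 fun i => ((hΨ i).pderiv i).coeFn_toL2
    filter_upwards [h2, Lp.coeFn_finsetSum Finset.univ fun i => ((hΨ i).pderiv i).toL2] with x hx hx'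
    rw [hx']
    simp [hx]
  rw [h]
  exact hasWeakDiv_of_hasWeakPartial fun i => (hΨ i).hasWeakPartial i

theorem memHdivZeroTrace_test (hΩ : IsOpen Ω) {Ψ : Fin d → EuclideanSpace ℝ (Fin d) → ℝ}
    (hΨ : ∀ i, IsTest Ω (Ψ i)) : MemHdivZeroTrace (fun i => (hΨ i).toL2) := by
  refine ⟨⟨_, hasWeakDiv_test hΨ⟩, fun _ => Ψ, fun _ => hΨ, fun i => ?_, ?_⟩
  · refine tendsto_const_nhds.congr fun n => ?_
    symm
    refine eLpNorm_eq_zero_of_ae_zero ?_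
    filter_upwards [(hΨ i).coeFn_toL2] with x hx
    simp [hx]
  · refine tendsto_const_nhds.congr fun n => ?_
    symm
    refine eLpNorm_eq_zero_of_ae_zero ?_
    rw [(hasWeakDiv_test hΨ).eq hΩ]
    filter_upwards [(IsTest.sum Finset.univ fun i => (hΨ i).pderiv i).coeFn_toL2] with x hx
    simp [hx]

theorem IsTest.sub (hψ : IsTest Ω ψ) (hχ : IsTest Ω χ) : IsTest Ω (fun x => ψ x - χ x) :=
  ⟨hψ.1.sub hχ.1, hψ.2.1.sub hχ.2.1,
    (tsupport_sub ψ χ).trans (Set.union_subset hψ.2.2 hχ.2.2)⟩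

theorem pderiv_sub (hψ : IsTest Ω ψ) (hχ : IsTest Ω χ) (j : Fin d) (x : EuclideanSpace ℝ (Fin d)) :
    pderiv j (fun x => ψ x - χ x) x = pderiv j ψ x - pderiv j χ x := by
  have h := ((hψ.differentiable x).hasFDerivAt.sub (hχ.differentiable x).hasFDerivAt).fderiv
  have h' : fderiv ℝ (fun x => ψ x - χ x) x = _ := h
  simp [pderiv, h']

/-- Subtracting a test field does not leave the space of fields with vanishing normal trace. -/
theorem MemHdivZeroTrace.sub_test (hΩ : IsOpen Ω) {w : Field Ω} (hw : MemHdivZeroTrace w)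
    {Ψ : Fin d → EuclideanSpace ℝ (Fin d) → ℝ} (hΨ : ∀ i, IsTest Ω (Ψ i)) :
    MemHdivZeroTrace (w - fun i => (hΨ i).toL2) ∧
      weakDiv (w - fun i => (hΨ i).toL2) =
        weakDiv w - (IsTest.sum Finset.univ fun i => (hΨ i).pderiv i).toL2 := by
  have hdiv : HasWeakDiv (w - fun i => (hΨ i).toL2)
      (weakDiv w - (IsTest.sum Finset.univ fun i => (hΨ i).pderiv i).toL2) := by
    have := (hw.1.hasWeakDiv hΩ).add ((hasWeakDiv_test hΨ).smul (-1))
    simpa only [neg_one_smul, ← sub_eq_add_neg] using this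
  refine ⟨⟨⟨_, hdiv⟩, ?_⟩, hdiv.eq hΩ⟩
  obtain ⟨-, Φ, hΦ, h1, h2⟩ := hw
  refine ⟨fun n i x => Φ n i x - Ψ i x, fun n i => (hΦ n i).sub (hΨ i), fun i => ?_, ?_⟩
  · refine (h1 i).congr fun n => eLpNorm_congr_ae ?_
    filter_upwards [(hΨ i).coeFn_toL2, Lp.coeFn_sub (w i) (hΨ i).toL2] with x hx hx'
    simp only [Pi.sub_apply] at hx' ⊢
    rw [hx', hx]; ring
  · rw [hdiv.eq hΩ]
    refine h2.congr fun n => eLpNorm_congr_ae ?_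
    filter_upwards [(IsTest.sum Finset.univ fun i => (hΨ i).pderiv i).coeFn_toL2,
      Lp.coeFn_sub (weakDiv w) (IsTest.sum Finset.univ fun i => (hΨ i).pderiv i).toL2] with x hx hx'
    simp only [pderiv_sub (hΦ n _) (hΨ _), Finset.sum_sub_distrib]
    rw [hx', Pi.sub_apply, hx]; ring

theorem MemHdivZeroTrace.exists_seq {w : Field Ω} (hw : MemHdivZeroTrace w) :
    ∃ (Ψ : ℕ → Fin d → EuclideanSpace ℝ (Fin d) → ℝ) (hΨ : ∀ n i, IsTest Ω (Ψ n i)),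
      (∀ i, Tendsto (fun n => (hΨ n i).toL2) atTop (𝓝 (w i))) ∧
      Tendsto (fun n => (IsTest.sum Finset.univ fun i => (hΨ n i).pderiv i).toL2) atTop
        (𝓝 (weakDiv w)) := by
  obtain ⟨-, Ψ, hΨ, h1, h2⟩ := hw
  exact ⟨Ψ, hΨ, fun i => tendsto_toL2 (fun n => hΨ n i) _ (h1 i),
    tendsto_toL2 (fun n => IsTest.sum Finset.univ fun i => (hΨ n i).pderiv i) _ h2⟩

/-- A gradient force acts on a field with vanishing normal trace through its divergence. -/
theorem IsGradientForce.apply_eq (hΩ : IsOpen Ω) {φ : L2 Ω} {f : Field Ω → ℝ}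
    (hf : IsGradientForce φ f) {w : Field Ω} (hw : MemHdivZeroTrace w) :
    f w = -inner ℝ φ (weakDiv w) := by
  obtain ⟨Ψ, hΨ, h1, h2⟩ := hw.exists_seq
  obtain ⟨C, hC⟩ := hf.bounded
  set T : ℕ → Field Ω := fun n i => (hΨ n i).toL2
  set δ : ℕ → L2 Ω := fun n => (IsTest.sum Finset.univ fun i => (hΨ n i).pderiv i).toL2
  have hval : ∀ n, f (T n) = -inner ℝ φ (δ n) := fun n => by
    rw [IsTest.inner_toL2]
    exact hf.eq_grad (Ψ n) (hΨ n) _ fun i => (hΨ n i).coeFn_toL2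
  -- Additivity of `f` is available only on fields of zero trace, so both summands must be shown to
  -- lie there. Boundedness of `f` then makes the first one vanish in the limit.
  have hsub : ∀ n, f w = f (w - T n) + f (T n) := fun n => by
    rw [← hf.map_add _ _ (hw.sub_test hΩ (hΨ n)).1 (memHdivZeroTrace_test hΩ (hΨ n))]
    simp
  have hnorm : Tendsto (fun n => C * hdivNorm (w - T n)) atTop (𝓝 0) := by
    have e : ∀ n, hdivNorm (w - T n) =
        Real.sqrt (∑ i, ‖w i - (hΨ n i).toL2‖ ^ 2 + ‖weakDiv w - δ n‖ ^ 2) := fun n => by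
      rw [hdivNorm, (hw.sub_test hΩ (hΨ n)).2]; rfl
    simp only [e]
    have h0 : Tendsto (fun n => ∑ i, ‖w i - (hΨ n i).toL2‖ ^ 2 + ‖weakDiv w - δ n‖ ^ 2) atTop
        (𝓝 (∑ i, ‖w i - w i‖ ^ 2 + ‖weakDiv w - weakDiv w‖ ^ 2)) :=
      (tendsto_finsetSum _ fun i _ => ((tendsto_const_nhds.sub (h1 i)).norm.pow 2)).add
        ((tendsto_const_nhds.sub h2).norm.pow 2)
    have h3 := (Real.continuous_sqrt.tendsto _).comp h0
    simpa using h3.const_mul C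
  have hd : Tendsto (fun n => f (w - T n)) atTop (𝓝 0) :=
    squeeze_zero_norm (fun n => hC _ (hw.sub_test hΩ (hΨ n)).1) hnorm
  have hlim : Tendsto (fun n => f (w - T n) + f (T n)) atTop
      (𝓝 (0 + -inner ℝ φ (weakDiv w))) := by
    simp only [hval]
    exact hd.add (tendsto_const_nhds.inner h2).neg
  simp only [← hsub, zero_add] at hlim
  exact tendsto_nhds_unique tendsto_const_nhds hlim

theorem integrable_test_restrict (hψ : IsTest Ω ψ) : Integrable ψ (volume.restrict Ω) :=
  (hψ.1.continuous.integrable_of_hasCompactSupport hψ.2.1).restrict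

/-- The constant function one in `L²(Ω)`, for bounded `Ω`. -/
theorem exists_one (hΩb : Bornology.IsBounded Ω) :
    ∃ e : L2 Ω, ∀ q : L2 Ω, inner ℝ e q = ∫ x in Ω, q x := by
  have : IsFiniteMeasure (volume.restrict Ω) := ⟨by simpa using hΩb.measure_lt_top⟩
  refine ⟨(memLp_const (1 : ℝ)).toLp _, fun q => ?_⟩
  rw [L2.inner_def]
  refine integral_congr_ae ?_
  filter_upwards [(memLp_const (μ := volume.restrict Ω) (p := 2) (1 : ℝ)).coeFn_toLp] with x hx
  rw [hx]
  simp

/-- The divergence theorem for fields with vanishing normal trace. -/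
theorem MemHdivZeroTrace.inner_one_weakDiv {e : L2 Ω}
    (he : ∀ q : L2 Ω, inner ℝ e q = ∫ x in Ω, q x) {w : Field Ω} (hw : MemHdivZeroTrace w) :
    inner ℝ e (weakDiv w) = 0 := by
  obtain ⟨Ψ, hΨ, -, h2⟩ := hw.exists_seq
  have h3 := (tendsto_const_nhds (x := e)).inner h2 (𝕜 := ℝ)
  refine tendsto_nhds_unique h3 (tendsto_const_nhds.congr fun n => ?_)
  rw [he, integral_congr_ae (IsTest.coeFn_toL2 _), integral_finsetSum]
  · simp [integral_pderiv_eq_zero (hΨ n _)]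
  · exact fun i _ => integrable_test_restrict ((hΨ n i).pderiv i)

/-! ### Korn's and Poincaré's inequality on `H¹₀` -/

theorem MemH10.exists_seq {u : L2 Ω} (hu : MemH10 u) :
    ∃ (ψ : ℕ → EuclideanSpace ℝ (Fin d) → ℝ) (hψ : ∀ n, IsTest Ω (ψ n)),
      Tendsto (fun n => (hψ n).toL2) atTop (𝓝 u) ∧
      ∀ j, Tendsto (fun n => ((hψ n).pderiv j).toL2) atTop (𝓝 (weakPartial j u)) := by
  obtain ⟨-, ψ, hψ, h1, h2⟩ := hu
  exact ⟨ψ, hψ, tendsto_toL2 hψ _ h1, fun j => tendsto_toL2 (fun n => (hψ n).pderiv j) _ (h2 j)⟩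

theorem MemH10.hasWeakPartial (hΩ : IsOpen Ω) {u : L2 Ω} (hu : MemH10 u) (j : Fin d) :
    HasWeakPartial j u (weakPartial j u) :=
  hasWeakPartial_weakPartial hΩ (hu.1 j)

/-- For a test function `χ` in place of `v`, both sides equal `-(u, ∂ᵢ∂ⱼχ)`; then pass to the limit.
-/
theorem inner_weakPartial_comm (hΩ : IsOpen Ω) {u v : L2 Ω} (hu : MemH10 u) (hv : MemH10 v)
    (i j : Fin d) :
    inner ℝ (weakPartial j u) (weakPartial i v) = inner ℝ (weakPartial i u) (weakPartial j v) := by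
  obtain ⟨χ, hχ, -, h⟩ := hv.exists_seq
  refine tendsto_nhds_unique ((tendsto_const_nhds (x := weakPartial j u)).inner (h i) (𝕜 := ℝ))
    (((tendsto_const_nhds (x := weakPartial i u)).inner (h j) (𝕜 := ℝ)).congr fun n => ?_)
  have a := hasWeakPartial_iff.1 (hu.hasWeakPartial hΩ j) _ ((hχ n).pderiv i)
  have b := hasWeakPartial_iff.1 (hu.hasWeakPartial hΩ i) _ ((hχ n).pderiv j)
  simp only [IsTest.inner_toL2, pderiv_comm (hχ n) i j] at a b ⊢
  linarith

/-- Testing `∂ⱼu` with `xⱼχₙ`, where `χₙ → u`, gives in the limit `‖u‖² ≤ 2R ‖u‖ ‖∂ⱼu‖`. -/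
theorem MemH10.norm_le (hΩ : IsOpen Ω) {R : ℝ} (hR : ∀ x ∈ Ω, ‖x‖ ≤ R) {u : L2 Ω}
    (hu : MemH10 u) (j : Fin d) : ‖u‖ ≤ 2 * R * ‖weakPartial j u‖ := by
  obtain ⟨χ, hχ, h0, h1⟩ := hu.exists_seq
  have hmul : ∀ {χ} (h : IsTest Ω χ), ‖(h.coord_mul j).toL2‖ ≤ R * ‖h.toL2‖ := fun {χ} h => by
    refine Lp.norm_le_mul_norm_of_ae_le_mul ?_
    filter_upwards [h.coeFn_toL2, (h.coord_mul j).coeFn_toL2,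
      ae_restrict_mem hΩ.measurableSet] with x hx hx' hxΩ
    rw [hx, hx', norm_mul]
    exact mul_le_mul_of_nonneg_right ((PiLp.norm_apply_le x j).trans (hR x hxΩ)) (norm_nonneg _)
  have hn : ∀ n, inner ℝ u (hχ n).toL2 ≤
      R * (‖u‖ * ‖((hχ n).pderiv j).toL2‖) + R * (‖weakPartial j u‖ * ‖(hχ n).toL2‖) := by
    intro n
    have a := hasWeakPartial_iff.1 (hu.hasWeakPartial hΩ j) _ ((hχ n).coord_mul j)
    have e : (((hχ n).coord_mul j).pderiv j).toL2 =
        (hχ n).toL2 + (((hχ n).pderiv j).coord_mul j).toL2 := by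
      refine Lp.ext ?_
      filter_upwards [(((hχ n).coord_mul j).pderiv j).coeFn_toL2, (hχ n).coeFn_toL2,
        (((hχ n).pderiv j).coord_mul j).coeFn_toL2,
        Lp.coeFn_add (hχ n).toL2 (((hχ n).pderiv j).coord_mul j).toL2] with x h1 h2 h3 h4
      rw [h1, h4, Pi.add_apply, h2, h3, pderiv_coord_mul (hχ n)]
    rw [e, inner_add_right] at a
    have b := neg_le_of_abs_le (abs_real_inner_le_norm u (((hχ n).pderiv j).coord_mul j).toL2)
    have c := neg_le_of_abs_le (abs_real_inner_le_norm (weakPartial j u) ((hχ n).coord_mul j).toL2)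
    have b' := mul_le_mul_of_nonneg_left (hmul ((hχ n).pderiv j)) (norm_nonneg u)
    have c' := mul_le_mul_of_nonneg_left (hmul (hχ n)) (norm_nonneg (weakPartial j u))
    linarith
  have hlim := le_of_tendsto_of_tendsto' ((tendsto_const_nhds (x := u)).inner h0 (𝕜 := ℝ))
    (((((h1 j).norm.const_mul ‖u‖).const_mul R)).add
      ((h0.norm.const_mul ‖weakPartial j u‖).const_mul R)) hn
  rw [real_inner_self_eq_norm_sq] at hlim
  rcases (norm_nonneg u).eq_or_lt with h | h
  -- The sign of `R` is not known (`Ω` may be empty), so for `u = 0` the right-hand side is shown to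
  -- vanish.
  · rw [← h]
    by_contra! hneg
    rw [norm_eq_zero.1 h.symm] at hneg
    have : weakPartial j (0 : L2 Ω) = 0 := by
      refine HasWeakPartial.eq hΩ (hasWeakPartial_iff.2 fun ψ hψ => by simp)
    simp [this] at hneg
  · nlinarith

end Elasticity

/-! ### Perturbed saddle point problems -/

section Saddle

variable {V G H : Type*} [AddCommGroup V] [Module ℝ V]
  [NormedAddCommGroup G] [InnerProductSpace ℝ G] [NormedAddCommGroup H] [InnerProductSpace ℝ H]
  {S : V →ₗ[ℝ] G} {B R : V →ₗ[ℝ] H} {Q : Submodule ℝ H} {mu lam : ℝ}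

/-- The `1/λ` term makes the system definite, so no inf-sup condition is needed: injectivity gives
surjectivity by dimension count. -/
theorem saddle_existsUnique [FiniteDimensional ℝ V] [FiniteDimensional ℝ Q]
    (hS : Function.Injective S) (hmu : 0 < mu) (hlam : 0 < lam) (l : V →ₗ[ℝ] ℝ) :
    ∃! s : V × Q, (∀ v, 2 * mu * inner ℝ (S s.1) (S v) + inner ℝ (s.2 : H) (B v) = l v) ∧
      ∀ q ∈ Q, inner ℝ q (B s.1) - 1 / lam * inner ℝ (s.2 : H) q = 0 := by
  let A : (V × Q) →ₗ[ℝ] Module.Dual ℝ (V × Q) := LinearMap.mk₂ ℝ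
    -- The second equation enters with a minus sign, so that the coupling terms cancel on the
    -- diagonal `t = s`.
    (fun s t => 2 * mu * inner ℝ (S s.1) (S t.1) + inner ℝ (s.2 : H) (B t.1)
      - (inner ℝ (t.2 : H) (B s.1) - 1 / lam * inner ℝ (s.2 : H) (t.2 : H)))
    (fun a b c => by simp [inner_add_left, inner_add_right]; ring)
    (fun r a b => by simp [real_inner_smul_left, real_inner_smul_right]; ring)
    (fun a b c => by simp [inner_add_left, inner_add_right]; ring)
    (fun r a b => by simp [real_inner_smul_left, real_inner_smul_right]; ring)
  have hA : ∀ s t, A s t = 2 * mu * inner ℝ (S s.1) (S t.1) + inner ℝ (s.2 : H) (B t.1)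
      - (inner ℝ (t.2 : H) (B s.1) - 1 / lam * inner ℝ (s.2 : H) (t.2 : H)) := fun _ _ => rfl
  have hinj : Function.Injective A := by
    rw [injective_iff_map_eq_zero]
    intro s hs
    have h := hA s s
    rw [hs, LinearMap.zero_apply, real_inner_self_eq_norm_sq, real_inner_self_eq_norm_sq] at h
    have h1 : 0 ≤ 1 / lam * ‖(s.2 : H)‖ ^ 2 := by positivity
    have h2 : 0 ≤ 2 * mu * ‖S s.1‖ ^ 2 := by positivity
    have h3 : 2 * mu * ‖S s.1‖ ^ 2 = 0 := by linarith
    have h4 : 1 / lam * ‖(s.2 : H)‖ ^ 2 = 0 := by linarith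
    refine Prod.ext ?_ ?_
    · have : S s.1 = 0 := by simpa [hmu.ne'] using h3
      exact hS (by simpa using this)
    · simpa [hlam.ne'] using h4
  have hsurj : Function.Surjective A :=
    (LinearMap.injective_iff_surjective_of_finrank_eq_finrank
      Subspace.dual_finrank_eq.symm).1 hinj
  have hiff : ∀ s : V × Q, ((∀ v, 2 * mu * inner ℝ (S s.1) (S v) + inner ℝ (s.2 : H) (B v) = l v) ∧
      ∀ q ∈ Q, inner ℝ q (B s.1) - 1 / lam * inner ℝ (s.2 : H) q = 0) ↔
      A s = l ∘ₗ LinearMap.fst ℝ V Q := by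
    intro s
    constructor
    · rintro ⟨h1, h2⟩
      refine LinearMap.ext fun t => ?_
      rw [hA, h1, h2 _ t.2.2]
      simp
    · intro h
      refine ⟨fun v => ?_, fun q hq => ?_⟩
      · simpa [hA] using LinearMap.congr_fun h (v, 0)
      · have := LinearMap.congr_fun h (0, ⟨q, hq⟩)
        simp only [hA, LinearMap.comp_apply, LinearMap.fst_apply, map_zero, inner_zero_right,
          mul_zero] at this
        linarith
  simp only [hiff]
  obtain ⟨s, hs⟩ := hsurj (l ∘ₗ LinearMap.fst ℝ V Q)
  exact ⟨s, hs, fun t ht => hinj (ht.trans hs.symm)⟩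

/-- In the application `S` is the strain, `B` the divergence, `R` the divergence of the
reconstruction, `e` the constant one and `N` the `H¹` seminorm. -/
theorem saddle_estimate [FiniteDimensional ℝ Q] {β K : ℝ} {N : V → ℝ} {e φ : H}
    (hR : ∀ v, R v ∈ Q) (hRB : ∀ v, ∀ q ∈ Q, inner ℝ q (R v) = inner ℝ q (B v))
    (he : ∀ v, inner ℝ e (R v) = 0) (hN : ∀ v, ‖S v‖ ≤ N v) (hB : ∀ v, ‖B v‖ ≤ K * ‖S v‖)
    (hK : 0 ≤ K) (hβ : 0 < β)
    (hinf : ∀ q ∈ Q, inner ℝ e q = 0 → q ≠ 0 → ∃ v, 0 < N v ∧ β * ‖q‖ * N v ≤ inner ℝ q (B v))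
    (hmu : 0 < mu) (hlam : 0 < lam) {u : V} {p : H} (hp : p ∈ Q)
    (h1 : ∀ v, 2 * mu * inner ℝ (S u) (S v) + inner ℝ p (B v) = -inner ℝ φ (R v))
    (h2 : ∀ q ∈ Q, inner ℝ q (B u) - 1 / lam * inner ℝ p q = 0) :
    (lam + mu) * ‖S u‖ ≤ (1 / β + K) * ‖φ‖ := by
  set P : H := Q.starProjection φ
  have hPQ : P ∈ Q := Q.starProjection_apply_mem φ
  have hPφ : ∀ q ∈ Q, inner ℝ P q = inner ℝ φ q := fun q hq => by
    have := Q.starProjection_inner_eq_zero φ q hq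
    rw [inner_sub_left] at this
    linarith
  have hPn : ‖P‖ ≤ ‖φ‖ := Q.norm_starProjection_apply_le φ
  set r : H := p + P
  have hrQ : r ∈ Q := Q.add_mem hp hPQ
  have hr : ∀ v, 2 * mu * inner ℝ (S u) (S v) = -inner ℝ r (B v) := fun v => by
    have a := h1 v
    have b : inner ℝ φ (R v) = inner ℝ P (B v) := by rw [← hPφ _ (hR v), hRB v P hPQ]
    rw [inner_add_left]
    linarith
  -- Inf-sup is available only on mean-free pressures. Since `R v` lies in `Q₀`, projecting `r` onto
  -- `Q₀` does not change its pairing with `B v`.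
  set Q₀ : Submodule ℝ H := Q ⊓ (Submodule.span ℝ {e})ᗮ
  have : FiniteDimensional ℝ Q₀ := Submodule.finiteDimensional_inf_left _ _
  have hQ₀ : ∀ q, q ∈ Q₀ ↔ q ∈ Q ∧ inner ℝ e q = 0 := fun q => by
    rw [Submodule.mem_inf, Submodule.mem_orthogonal_singleton_iff_inner_right]
  set r₀ : H := Q₀.starProjection r
  obtain ⟨hr₀Q, hr₀e⟩ := (hQ₀ r₀).1 (Q₀.starProjection_apply_mem r)
  have hr₀ : ∀ v, inner ℝ r (B v) = inner ℝ r₀ (B v) := fun v => by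
    rw [← hRB v r hrQ, ← hRB v r₀ hr₀Q]
    have := Q₀.starProjection_inner_eq_zero r (R v) ((hQ₀ _).2 ⟨hR v, he v⟩)
    rw [inner_sub_left] at this
    linarith
  have hE : 2 * mu * ‖S u‖ ^ 2 = -inner ℝ r (B u) := by
    rw [← real_inner_self_eq_norm_sq]; exact hr u
  -- The energy identity with `q = r` gives `(p, p + P) ≤ 0`, that is, `‖p‖² ≤ -(φ, p)`.
  have hpφ : ‖p‖ ≤ ‖φ‖ := by
    have a := h2 r hrQ
    have b : 0 ≤ 2 * mu * ‖S u‖ ^ 2 := by positivity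
    have c : 1 / lam * inner ℝ p r ≤ 0 := by linarith
    have c' : inner ℝ p r ≤ 0 := by
      by_contra! hc
      have : 0 < 1 / lam * inner ℝ p r := by positivity
      linarith
    rw [inner_add_right, real_inner_self_eq_norm_sq, real_inner_comm, hPφ p hp] at c'
    have g := neg_le_of_abs_le (abs_real_inner_le_norm φ p)
    by_contra! hc
    nlinarith [norm_nonneg φ]
  have hmu_est : mu * ‖S u‖ ≤ K * ‖φ‖ := by
    have a := neg_le_of_abs_le (abs_real_inner_le_norm r (B u))
    have b : ‖r‖ ≤ 2 * ‖φ‖ := (norm_add_le _ _).trans (by linarith)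
    have c : ‖r‖ * ‖B u‖ ≤ 2 * ‖φ‖ * (K * ‖S u‖) :=
      mul_le_mul b (hB u) (norm_nonneg _) (by positivity)
    rcases (norm_nonneg (S u)).eq_or_lt with h | h
    · rw [← h, mul_zero]; positivity
    · refine le_of_mul_le_mul_right ?_ h
      linarith
  have hlam_est : lam * ‖S u‖ ≤ 1 / β * ‖φ‖ := by
    have a : β * ‖r₀‖ ≤ 2 * mu * ‖S u‖ := by
      by_cases h0 : r₀ = 0
      · rw [h0, norm_zero, mul_zero]; positivity
      · obtain ⟨v, hv, hv'⟩ := hinf r₀ hr₀Q hr₀e h0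
        refine le_of_mul_le_mul_right ?_ hv
        have b := neg_le_of_abs_le (abs_real_inner_le_norm (S u) (S v))
        have c := mul_le_mul_of_nonneg_left (hN v) (norm_nonneg (S u))
        have g := hr v
        rw [hr₀ v] at g
        have : 2 * mu * -(‖S u‖ * N v) ≤ 2 * mu * inner ℝ (S u) (S v) :=
          mul_le_mul_of_nonneg_left (by linarith) (by positivity)
        linarith
    have b := h2 r₀ hr₀Q
    have c := neg_le_of_abs_le (abs_real_inner_le_norm p r₀)
    have g : ‖p‖ * ‖r₀‖ ≤ ‖φ‖ * ‖r₀‖ := mul_le_mul_of_nonneg_right hpφ (norm_nonneg _)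
    rw [hr₀ u] at hE
    have k : lam * (2 * mu * ‖S u‖ ^ 2) = -inner ℝ p r₀ := by
      rw [hE, sub_eq_zero.1 b]; field_simp
    -- The factor `2 * mu * ‖S u‖` occurs on both sides; cancelling it makes the bound uniform in
    -- `μ`.
    have m : β * (lam * (2 * mu * ‖S u‖ ^ 2)) ≤ ‖φ‖ * (2 * mu * ‖S u‖) := by
      rw [k]
      calc β * -inner ℝ p r₀ ≤ β * (‖φ‖ * ‖r₀‖) := mul_le_mul_of_nonneg_left (by linarith) hβ.le
        _ = ‖φ‖ * (β * ‖r₀‖) := by ring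
        _ ≤ _ := mul_le_mul_of_nonneg_left a (norm_nonneg _)
    rw [one_div, inv_mul_eq_div, le_div_iff₀ hβ]
    rcases (norm_nonneg (S u)).eq_or_lt with h | h
    · rw [← h]; simp
    · refine le_of_mul_le_mul_right ?_ (show 0 < 2 * mu * ‖S u‖ by positivity)
      linarith
  linarith

end Saddle

namespace Elasticity

variable {d : ℕ} {Ω : Set (EuclideanSpace ℝ (Fin d))}

/-! ### Norms of fields with components in `H¹₀` -/

theorem MemH10.hasWeakDiv (hΩ : IsOpen Ω) {v : Field Ω} (hv : ∀ i, MemH10 (v i)) :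
    HasWeakDiv v (∑ i, weakPartial i (v i)) :=
  hasWeakDiv_of_hasWeakPartial fun i => (hv i).hasWeakPartial hΩ i

theorem h1Seminorm_sq (v : Field Ω) :
    h1Seminorm v ^ 2 = ∑ i, ∑ j, ‖weakPartial j (v i)‖ ^ 2 :=
  Real.sq_sqrt (by positivity)

theorem h1Norm_sq (v : Field Ω) :
    h1Norm v ^ 2 = ∑ i, ‖v i‖ ^ 2 + h1Seminorm v ^ 2 := by
  rw [h1Norm, Real.sq_sqrt (by positivity), h1Seminorm_sq]

/-- Exchanging the two derivatives turns the summands into `(∂ᵢvᵢ, ∂ⱼvⱼ)`. -/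
theorem sum_inner_transpose (hΩ : IsOpen Ω) {v : Field Ω} (hv : ∀ i, MemH10 (v i)) :
    ∑ i, ∑ j, inner ℝ (weakPartial j (v i)) (weakPartial i (v j)) = ‖weakDiv v‖ ^ 2 := by
  rw [(MemH10.hasWeakDiv hΩ hv).eq hΩ, ← real_inner_self_eq_norm_sq, sum_inner]
  refine Finset.sum_congr rfl fun i _ => ?_
  rw [inner_sum]
  exact Finset.sum_congr rfl fun j _ => inner_weakPartial_comm hΩ (hv i) (hv j) i j

/-- Korn's identity. -/
theorem two_mul_sum_strain_sq (hΩ : IsOpen Ω) {v : Field Ω} (hv : ∀ i, MemH10 (v i)) :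
    2 * ∑ i, ∑ j, ‖strain v i j‖ ^ 2 = h1Seminorm v ^ 2 + ‖weakDiv v‖ ^ 2 := by
  have e : ∀ i j, ‖strain v i j‖ ^ 2 = 1 / 4 * ‖weakPartial j (v i)‖ ^ 2 +
      1 / 2 * inner ℝ (weakPartial j (v i)) (weakPartial i (v j)) +
      1 / 4 * ‖weakPartial i (v j)‖ ^ 2 := fun i j => by
    rw [strain, norm_smul, mul_pow, norm_add_sq_real]
    norm_num
    ring
  have hc : ∑ i, ∑ j, ‖weakPartial i (v j)‖ ^ 2 = ∑ i, ∑ j, ‖weakPartial j (v i)‖ ^ 2 :=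
    Finset.sum_comm
  simp only [e, Finset.sum_add_distrib, ← Finset.mul_sum, sum_inner_transpose hΩ hv, hc,
    h1Seminorm_sq]
  ring

/-- Young's inequality on the transposed sum gives constant one, without a factor `d`. -/
theorem norm_weakDiv_le_h1Seminorm (hΩ : IsOpen Ω) {v : Field Ω} (hv : ∀ i, MemH10 (v i)) :
    ‖weakDiv v‖ ^ 2 ≤ h1Seminorm v ^ 2 := by
  have hc : ∑ i, ∑ j, ‖weakPartial i (v j)‖ ^ 2 = ∑ i, ∑ j, ‖weakPartial j (v i)‖ ^ 2 :=
    Finset.sum_comm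
  have h : ∑ i, ∑ j, inner ℝ (weakPartial j (v i)) (weakPartial i (v j)) ≤
      ∑ i, ∑ j, (1 / 2 * ‖weakPartial j (v i)‖ ^ 2 + 1 / 2 * ‖weakPartial i (v j)‖ ^ 2) :=
    Finset.sum_le_sum fun i _ => Finset.sum_le_sum fun j _ => by
      have := real_inner_le_norm (weakPartial j (v i)) (weakPartial i (v j))
      nlinarith [sq_nonneg (‖weakPartial j (v i)‖ - ‖weakPartial i (v j)‖)]
  simp only [Finset.sum_add_distrib, ← Finset.mul_sum, hc] at h
  rw [← sum_inner_transpose hΩ hv, h1Seminorm_sq]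
  linarith

/-- Poincaré's inequality for fields. -/
theorem h1Norm_le (hΩ : IsOpen Ω) {R : ℝ} (hR0 : 0 ≤ R) (hR : ∀ x ∈ Ω, ‖x‖ ≤ R) {v : Field Ω}
    (hv : ∀ i, MemH10 (v i)) : h1Norm v ≤ (2 * R + 1) * h1Seminorm v := by
  have h : ∑ i, ‖v i‖ ^ 2 ≤ (2 * R) ^ 2 * h1Seminorm v ^ 2 := by
    rw [h1Seminorm_sq, Finset.mul_sum]
    refine Finset.sum_le_sum fun i _ => ?_
    -- Component `i` is differentiated in direction `i`, so a direction is always at hand, whatever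
    -- `d` is.
    have a := pow_le_pow_left₀ (norm_nonneg _) ((hv i).norm_le hΩ hR i) 2
    have b : ‖weakPartial i (v i)‖ ^ 2 ≤ ∑ j, ‖weakPartial j (v i)‖ ^ 2 :=
      Finset.single_le_sum (f := fun j => ‖weakPartial j (v i)‖ ^ 2)
        (fun j _ => by positivity) (Finset.mem_univ i)
    rw [mul_pow] at a
    exact a.trans (mul_le_mul_of_nonneg_left b (by positivity))
  have hs : 0 ≤ h1Seminorm v := Real.sqrt_nonneg _
  refine le_of_sq_le_sq ?_ (by positivity)
  rw [h1Norm_sq, mul_pow]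
  have : 0 ≤ R * h1Seminorm v ^ 2 := by positivity
  nlinarith

theorem eq_zero_of_h1Norm_le_zero {v : Field Ω} (h : h1Norm v ≤ 0) : v = 0 := by
  have h0 : h1Norm v = 0 := le_antisymm h (Real.sqrt_nonneg _)
  have h1 := h1Norm_sq v
  rw [h0] at h1
  have h2 : ∑ i, ‖v i‖ ^ 2 = 0 := le_antisymm (by nlinarith [sq_nonneg (h1Seminorm v)])
    (Finset.sum_nonneg fun i _ => by positivity)
  funext i
  have := (Finset.sum_eq_zero_iff_of_nonneg fun i _ => by positivity).1 h2 i (Finset.mem_univ i)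
  simpa using this

/-! ### The discrete problem -/

namespace MixedMethod

variable (D : MixedMethod Ω)

/-- The symmetric gradient on the discrete space. -/
noncomputable def strainMap (hΩ : IsOpen Ω) :
    D.V →ₗ[ℝ] PiLp 2 (fun _ : Fin d × Fin d => L2 Ω) where
  toFun v := WithLp.toLp 2 fun k => strain (v : Field Ω) k.1 k.2
  map_add' u v := by
    have h : ∀ i j, weakPartial j ((u + v : Field Ω) i) =
        weakPartial j ((u : Field Ω) i) + weakPartial j ((v : Field Ω) i) := fun i j =>
      (((D.V_subset u u.2 i).hasWeakPartial hΩ j).add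
        ((D.V_subset v v.2 i).hasWeakPartial hΩ j)).eq hΩ
    ext1 k
    simp only [strain, Submodule.coe_add, h, PiLp.add_apply, ← smul_add]
    congr 1
    abel
  map_smul' r v := by
    have h : ∀ i j, weakPartial j ((r • v : Field Ω) i) =
        r • weakPartial j ((v : Field Ω) i) := fun i j =>
      (((D.V_subset v v.2 i).hasWeakPartial hΩ j).smul r).eq hΩ
    ext1 k
    simp only [strain, Submodule.coe_smul, h, PiLp.smul_apply, RingHom.id_apply, ← smul_add]
    rw [smul_comm]

theorem norm_strainMap_sq (hΩ : IsOpen Ω) (v : D.V) :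
    ‖D.strainMap hΩ v‖ ^ 2 = ∑ i, ∑ j, ‖strain (v : Field Ω) i j‖ ^ 2 := by
  rw [PiLp.norm_sq_eq_of_L2, Fintype.sum_prod_type]
  rfl

theorem formA_eq (hΩ : IsOpen Ω) (mu : ℝ) (u v : D.V) :
    formA mu (u : Field Ω) (v : Field Ω) = 2 * mu * inner ℝ (D.strainMap hΩ u) (D.strainMap hΩ v) := by
  rw [PiLp.inner_apply, Fintype.sum_prod_type]
  rfl

/-- The divergence on the discrete space. -/
noncomputable def divMap (hΩ : IsOpen Ω) : D.V →ₗ[ℝ] L2 Ω where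
  toFun v := weakDiv (v : Field Ω)
  map_add' u v := by
    have hu := MemH10.hasWeakDiv hΩ (D.V_subset u u.2)
    have hv := MemH10.hasWeakDiv hΩ (D.V_subset v v.2)
    rw [Submodule.coe_add, (hu.add hv).eq hΩ, hu.eq hΩ, hv.eq hΩ]
  map_smul' r v := by
    have hv := MemH10.hasWeakDiv hΩ (D.V_subset v v.2)
    rw [Submodule.coe_smul, (hv.smul r).eq hΩ, hv.eq hΩ, RingHom.id_apply]

variable {D}

/-- The divergence of the reconstruction. -/
noncomputable def IsReconstruction.divMap (hD : D.IsReconstruction) (hΩ : IsOpen Ω) :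
    D.V →ₗ[ℝ] L2 Ω where
  toFun v := weakDiv (D.recon v)
  map_add' u v := by
    rw [map_add, (((hD.memHdiv u).hasWeakDiv hΩ).add ((hD.memHdiv v).hasWeakDiv hΩ)).eq hΩ]
  map_smul' r v := by
    rw [map_smul, (((hD.memHdiv v).hasWeakDiv hΩ).smul r).eq hΩ, RingHom.id_apply]

/-- Korn's identity gives the constant `√2`; here and in `norm_divMap_le` it is rounded up to `2`.
-/
theorem h1Seminorm_le_strainMap (hΩ : IsOpen Ω) (v : D.V) :
    h1Seminorm (v : Field Ω) ≤ 2 * ‖D.strainMap hΩ v‖ := by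
  refine le_of_sq_le_sq ?_ (by positivity)
  have h := two_mul_sum_strain_sq hΩ (D.V_subset v v.2)
  rw [mul_pow, norm_strainMap_sq]
  nlinarith [sq_nonneg ‖weakDiv (v : Field Ω)‖, sq_nonneg (h1Seminorm (v : Field Ω))]

theorem norm_divMap_le (hΩ : IsOpen Ω) (v : D.V) :
    ‖D.divMap hΩ v‖ ≤ 2 * ‖D.strainMap hΩ v‖ := by
  refine le_of_sq_le_sq ?_ (by positivity)
  have h := two_mul_sum_strain_sq hΩ (D.V_subset v v.2)
  rw [mul_pow, norm_strainMap_sq]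
  change ‖weakDiv (v : Field Ω)‖ ^ 2 ≤ _
  nlinarith [sq_nonneg ‖weakDiv (v : Field Ω)‖, sq_nonneg (h1Seminorm (v : Field Ω))]

theorem norm_strainMap_le (hΩ : IsOpen Ω) (v : D.V) :
    ‖D.strainMap hΩ v‖ ≤ h1Seminorm (v : Field Ω) := by
  refine le_of_sq_le_sq ?_ (Real.sqrt_nonneg _)
  have h := two_mul_sum_strain_sq hΩ (D.V_subset v v.2)
  have h' := norm_weakDiv_le_h1Seminorm hΩ (D.V_subset v v.2)
  rw [norm_strainMap_sq]
  linarith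

theorem h1Norm_le_strainMap (hΩ : IsOpen Ω) {R : ℝ} (hR0 : 0 ≤ R) (hR : ∀ x ∈ Ω, ‖x‖ ≤ R)
    (v : D.V) : h1Norm (v : Field Ω) ≤ (2 * R + 1) * 2 * ‖D.strainMap hΩ v‖ := by
  rw [mul_assoc]
  exact (h1Norm_le hΩ hR0 hR (D.V_subset v v.2)).trans
    (mul_le_mul_of_nonneg_left (h1Seminorm_le_strainMap hΩ v) (by positivity))

theorem strainMap_injective (hΩ : IsOpen Ω) {R : ℝ} (hR0 : 0 ≤ R) (hR : ∀ x ∈ Ω, ‖x‖ ≤ R) :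
    Function.Injective (D.strainMap hΩ) := by
  rw [injective_iff_map_eq_zero]
  intro v hv
  have h := h1Norm_le_strainMap hΩ hR0 hR v
  rw [hv, norm_zero, mul_zero] at h
  exact Subtype.ext (eq_zero_of_h1Norm_le_zero h)

/-- The supremum need not be attained, so `β` is lowered to some `γ < β` to get an actual field. -/
theorem InfSup.exists_field {β : ℝ} (h : D.InfSup β) {γ : ℝ} (hγ : 0 < γ) (hγβ : γ < β) {q : L2 Ω}
    (hq : q ∈ D.Q) (hmean : ∫ x in Ω, q x = 0) (hq0 : q ≠ 0) :
    ∃ v : D.V, 0 < h1Seminorm (v : Field Ω) ∧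
      γ * ‖q‖ * h1Seminorm (v : Field Ω) ≤ formB q v := by
  have h1 : ((γ : ℝ) : EReal) < ⨆ v ∈ {v : Field Ω | v ∈ D.V ∧ v ≠ 0},
      ((formB q v / (‖q‖ * h1Seminorm v) : ℝ) : EReal) :=
    (EReal.coe_lt_coe_iff.2 hγβ).trans_le (h.trans (iInf₂_le q ⟨hq, hmean, hq0⟩))
  simp only [lt_iSup_iff, EReal.coe_lt_coe_iff] at h1
  obtain ⟨v, ⟨hv, -⟩, hlt⟩ := h1
  -- With zero seminorm the quotient would be `0` by the convention for division, which does not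
  -- exceed `γ`.
  have hpos : 0 < h1Seminorm v := by
    refine (Real.sqrt_nonneg _).lt_of_ne fun h0 => ?_
    rw [show h1Seminorm v = 0 from h0.symm] at hlt
    simp at hlt
    linarith
  refine ⟨⟨v, hv⟩, hpos, ?_⟩
  rw [lt_div_iff₀ (mul_pos (norm_pos_iff.2 hq0) hpos)] at hlt
  linarith

theorem IsReconstruction.force_eq (hD : D.IsReconstruction) (hΩ : IsOpen Ω) {φ : L2 Ω}
    {f : Field Ω → ℝ} (hf : IsGradientForce φ f) (v : D.V) :
    f (D.recon v) = -inner ℝ φ (hD.divMap hΩ v) :=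
  hf.apply_eq hΩ (hD.zeroTrace v)

theorem IsReconstruction.existsUnique_isSolution (hD : D.IsReconstruction) (hΩ : IsOpen Ω)
    (hΩb : Bornology.IsBounded Ω) {mu lam : ℝ} (hmu : 0 < mu) (hlam : 0 < lam) {φ : L2 Ω}
    {f : Field Ω → ℝ} (hf : IsGradientForce φ f) :
    ∃! s : Field Ω × L2 Ω, D.IsSolution mu lam f s.1 s.2 := by
  have := D.finiteDimensional_V
  have := D.finiteDimensional_Q
  obtain ⟨R, hR0, hR⟩ := hΩb.exists_pos_norm_le
  obtain ⟨⟨u, p⟩, ⟨h1, h2⟩, huniq⟩ := saddle_existsUnique (B := D.divMap hΩ) (Q := D.Q)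
    (strainMap_injective hΩ hR0.le hR) hmu hlam (-(innerₗ (L2 Ω) φ ∘ₗ hD.divMap hΩ))
  refine ⟨(u, p), ⟨u.2, p.2, fun v => ?_, h2⟩, ?_⟩
  · rw [D.formA_eq hΩ, hD.force_eq hΩ hf]
    exact h1 v
  · rintro ⟨u', p'⟩ ⟨hu', hp', h1', h2'⟩
    have := huniq (⟨u', hu'⟩, ⟨p', hp'⟩) ⟨fun v => ?_, h2'⟩
    · obtain ⟨rfl, rfl⟩ := Prod.mk.inj this
      rfl
    · have h := h1' v
      rw [D.formA_eq hΩ mu ⟨u', hu'⟩, hD.force_eq hΩ hf] at h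
      exact h

theorem IsReconstruction.h1Norm_isSolution_le (hD : D.IsReconstruction) (hΩ : IsOpen Ω)
    (hΩb : Bornology.IsBounded Ω) {β : ℝ} (hβ : 0 < β) (hinfsup : D.InfSup β) {R : ℝ} (hR0 : 0 ≤ R)
    (hR : ∀ x ∈ Ω, ‖x‖ ≤ R) {mu lam : ℝ} (hmu : 0 < mu) (hlam : 0 < lam) {φ : L2 Ω}
    {f : Field Ω → ℝ} (hf : IsGradientForce φ f) {u : Field Ω} {p : L2 Ω}
    (hs : D.IsSolution mu lam f u p) :
    h1Norm u ≤ (2 * R + 1) * 2 * (1 / (β / 2) + 2) * (1 / (lam + mu)) * ‖φ‖ := by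
  have := D.finiteDimensional_Q
  obtain ⟨e, he⟩ := exists_one hΩb
  obtain ⟨hu, hp, h1, h2⟩ := hs
  have hest := saddle_estimate (S := D.strainMap hΩ) (B := D.divMap hΩ) (R := hD.divMap hΩ)
    (Q := D.Q) (N := fun v => h1Seminorm (v : Field Ω)) (e := e) (φ := φ) (u := ⟨u, hu⟩) (p := p)
    -- `K` is the constant of `norm_divMap_le`; `β / 2` is a choice of `γ` below `β`.
    (K := 2) (β := β / 2) (mu := mu) (lam := lam) hD.div_mem (fun v q hq => hD.formB_eq v q hq)
    (fun v => (hD.zeroTrace v).inner_one_weakDiv he) (norm_strainMap_le hΩ) (norm_divMap_le hΩ)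
    (by norm_num) (by positivity)
    (fun q hq hqe hq0 => hinfsup.exists_field (by positivity) (by linarith) hq
      ((he q).symm.trans hqe) hq0) hmu hlam hp
    (fun v => by
      have h := h1 v
      rw [D.formA_eq hΩ mu ⟨u, hu⟩, hD.force_eq hΩ hf] at h
      exact h)
    h2
  calc h1Norm u ≤ (2 * R + 1) * 2 * ‖D.strainMap hΩ ⟨u, hu⟩‖ :=
        h1Norm_le_strainMap hΩ hR0 hR ⟨u, hu⟩
    _ ≤ (2 * R + 1) * 2 * ((1 / (β / 2) + 2) * ‖φ‖ / (lam + mu)) := by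
        refine mul_le_mul_of_nonneg_left ?_ (by positivity)
        rw [le_div_iff₀ (by positivity), mul_comm]
        exact hest
    _ = _ := by ring

end MixedMethod

end Elasticity

/-! ### Uniform estimate and gradient robustness -/

theorem mainTheorem3 {d : ℕ} {Ω : Set (EuclideanSpace ℝ (Fin d))}
    (hΩ : IsOpen Ω) (hΩb : Bornology.IsBounded Ω)
    {ι : Type*} (D : ι → Elasticity.MixedMethod Ω)
    (hrec : ∀ h, (D h).IsReconstruction)
    (β : ℝ) (hβ : 0 < β) (hinfsup : ∀ h, (D h).InfSup β) :
    (∃ c : ℝ, 0 < c ∧ ∀ (h : ι) (mu lam : ℝ), 0 < mu → 0 < lam →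
      ∀ (φ : Elasticity.L2 Ω) (f : Elasticity.Field Ω → ℝ), Elasticity.IsGradientForce φ f →
        (∃! s : Elasticity.Field Ω × Elasticity.L2 Ω, (D h).IsSolution mu lam f s.1 s.2) ∧
        ∀ u p, (D h).IsSolution mu lam f u p →
          Elasticity.h1Norm u ≤ c * (1 / (lam + mu)) * ‖φ‖) ∧
    Elasticity.GradientRobust
      (fun h mu lam f u => ∃ p, (D h).IsSolution mu lam f u p) := by
  obtain ⟨R, hR0, hR⟩ := hΩb.exists_pos_norm_le
  have key : ∀ (h : ι) (mu lam : ℝ), 0 < mu → 0 < lam →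
      ∀ (φ : Elasticity.L2 Ω) (f : Elasticity.Field Ω → ℝ), Elasticity.IsGradientForce φ f →
      ∀ u p, (D h).IsSolution mu lam f u p → Elasticity.h1Norm u ≤
        (2 * R + 1) * 2 * (1 / (β / 2) + 2) * (1 / (lam + mu)) * ‖φ‖ :=
    fun h mu lam hmu hlam φ f hf u p hs =>
      (hrec h).h1Norm_isSolution_le hΩ hΩb hβ (hinfsup h) hR0.le hR hmu hlam hf hs
  refine ⟨⟨(2 * R + 1) * 2 * (1 / (β / 2) + 2), by positivity,
    fun h mu lam hmu hlam φ f hf => ⟨(hrec h).existsUnique_isSolution hΩ hΩb hmu hlam hf,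
      key h mu lam hmu hlam φ f hf⟩⟩, fun h => ⟨(2 * R + 1) * 2 * (1 / (β / 2) + 2), ?_⟩⟩
  rintro mu lam hmu hlam φ f hf u ⟨p, hs⟩
  -- The robust bound drops `μ` from the denominator; the same constant serves every `h`.
  refine (key h mu lam hmu hlam φ f hf u p hs).trans ?_
  rw [← mul_one_div _ lam]
  gcongr
  linarith
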